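/- Let $C$ be an algebraically closed field of characteristic zero and let $\hat K=\bigcup_{r\ge 1}C[[x^{1/r}]][x^{-1/r}]$ be the field of formal Puiseux series over $C$. For a matrix $M(x)$ over $\hat K$ and a positive integer $m$, let $M(x^m)$ be the matrix obtained by applying $\sum_s a_s x^s\mapsto\sum_s a_s x^{ms}$ to the entries of $M(x)$. Let $p,q\ge 2$ be multiplicatively independent integers, i.e. there are no nonzero integers $a,b$ with $p^a=q^b$. Let $n\ge 0$ and let $A(x),B(x)\in\mathrm{GL}_n(\hat K)$ satisfy the consistency condition $$A(x^q)\,B(x)=B(x^p)\,A(x).$$ Then $x=0$ is a regular singular point of the Mahler system $y(x^p)=A(x)\,y(x)$, that is, there exist $G(x)\in\mathrm{GL}_n(\hat K)$ and $A_0\in\mathrm{GL}_n(C)$ such that the gauge transformation $y=G(x)z$ changes the system into $z(x^p)=A_0\,z(x)$; in other words, $$G(x^p)^{-1}A(x)\,G(x)=A_0 .$$ -/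

import Mathlib

open scoped LaurentSeries Matrix

noncomputable section

namespace MahlerSystem

variable (C : Type*) [Field C]

/-- The embedding of rings `C⸨t⸩ → C⟦x^ℚ⟧` given by `t ↦ x^(1/r)`; its image is the field
`C[[x^(1/r)]][x^(-1/r)]`. -/
def ramify (r : ℕ+) : C⸨X⸩ →+* HahnSeries ℚ C :=
  HahnSeries.embDomainRingHom
    ((AddMonoidHom.mulRight ((r : ℕ) : ℚ)⁻¹).comp (Int.castAddHom ℚ))
    (fun a b h => by
      have hr : ((r : ℕ) : ℚ)⁻¹ ≠ 0 := inv_ne_zero (Nat.cast_ne_zero.2 r.ne_zero)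
      exact Int.cast_injective (α := ℚ) (mul_right_cancel₀ hr h))
    (fun a b => by
      have hr : (0 : ℚ) < ((r : ℕ) : ℚ)⁻¹ := inv_pos.2 (Nat.cast_pos.2 r.pos)
      exact (mul_le_mul_iff_of_pos_right hr).trans Int.cast_le)

/-- The substitution `x ↦ x^p` on Hahn series with rational exponents, that is,
`∑ a_s x^s ↦ ∑ a_s x^(p s)`. -/
def hahnSubst (p : ℕ+) : HahnSeries ℚ C →+* HahnSeries ℚ C :=
  HahnSeries.embDomainRingHom (AddMonoidHom.mulLeft ((p : ℕ) : ℚ))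
    (fun a b h => by
      have hp : ((p : ℕ) : ℚ) ≠ 0 := Nat.cast_ne_zero.2 p.ne_zero
      exact mul_left_cancel₀ hp h)
    (fun a b => by
      have hp : (0 : ℚ) < ((p : ℕ) : ℚ) := Nat.cast_pos.2 p.pos
      exact mul_le_mul_iff_of_pos_left hp)

variable {C} in
theorem ramify_coeff_mul_inv (r : ℕ+) (f : C⸨X⸩) (k : ℤ) :
    (ramify C r f).coeff ((k : ℚ) * ((r : ℕ) : ℚ)⁻¹) = f.coeff k :=
  HahnSeries.embDomain_coeff (a := k)

variable {C} in
theorem ramify_coeff_eq_zero (r : ℕ+) (f : C⸨X⸩) (s : ℚ)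
    (h : ∀ k : ℤ, (k : ℚ) * ((r : ℕ) : ℚ)⁻¹ ≠ s) : (ramify C r f).coeff s = 0 :=
  HahnSeries.embDomain_of_notMem_range (by rintro ⟨k, hk⟩; exact h k hk)

variable {C} in
theorem hahnSubst_coeff_mul (p : ℕ+) (f : HahnSeries ℚ C) (s : ℚ) :
    (hahnSubst C p f).coeff (((p : ℕ) : ℚ) * s) = f.coeff s :=
  HahnSeries.embDomain_coeff (a := s)

variable {C} in
/-- A Hahn series comes from `C⸨x^(1/r)⸩` exactly if its exponents lie in `(1/r)ℤ`. -/
theorem mem_range_ramify_iff (r : ℕ+) (f : HahnSeries ℚ C) :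
    f ∈ Set.range (ramify C r) ↔
      ∀ s ∈ f.support, ∃ k : ℤ, (k : ℚ) * ((r : ℕ) : ℚ)⁻¹ = s := by
  have hr : (0 : ℚ) < ((r : ℕ) : ℚ)⁻¹ := inv_pos.2 (Nat.cast_pos.2 r.pos)
  constructor
  · rintro ⟨g, rfl⟩ s hs
    by_contra! h
    exact hs (ramify_coeff_eq_zero r g s h)
  · intro h
    have hpwo : (Function.support fun k : ℤ => f.coeff ((k : ℚ) * ((r : ℕ) : ℚ)⁻¹)).IsPWO := by
      refine Set.IsWF.isPWO (Set.isWF_iff_no_descending_seq.2 ?_)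
      intro g hg hmem
      refine Set.isWF_iff_no_descending_seq.1 f.isWF_support
        (fun n => (g n : ℚ) * ((r : ℕ) : ℚ)⁻¹) ?_ ?_
      · intro a b hab
        exact mul_lt_mul_of_pos_right (Int.cast_lt.2 (hg hab)) hr
      · exact fun n => hmem n
    refine ⟨⟨fun k => f.coeff ((k : ℚ) * ((r : ℕ) : ℚ)⁻¹), hpwo⟩, ?_⟩
    ext s
    by_cases hs : ∃ k : ℤ, (k : ℚ) * ((r : ℕ) : ℚ)⁻¹ = s
    · obtain ⟨k, rfl⟩ := hs
      exact ramify_coeff_mul_inv r _ k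
    · rw [ramify_coeff_eq_zero r _ s (by simpa using hs)]
      by_contra hne
      exact hs (h s (fun h0 => hne h0.symm))

variable {C} in
theorem range_ramify_subset (r s : ℕ+) :
    Set.range (ramify C r) ⊆ Set.range (ramify C (r * s)) := by
  intro f hf
  rw [mem_range_ramify_iff] at hf ⊢
  intro u hu
  obtain ⟨k, rfl⟩ := hf u hu
  have hs : ((s : ℕ) : ℚ) ≠ 0 := Nat.cast_ne_zero.2 s.ne_zero
  have hr : ((r : ℕ) : ℚ) ≠ 0 := Nat.cast_ne_zero.2 r.ne_zero
  refine ⟨k * (s : ℕ), ?_⟩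
  push_cast
  field_simp

/-- The field `⋃_{r ≥ 1} C[[x^(1/r)]][x^(-1/r)]` of formal Puiseux series, inside the Hahn series
with rational exponents. -/
def Puiseux : Subfield (HahnSeries ℚ C) where
  carrier := ⋃ r : ℕ+, Set.range (ramify C r)
  mul_mem' := by
    intro a b ha hb
    obtain ⟨r, hr⟩ := Set.mem_iUnion.1 ha
    obtain ⟨s, hs⟩ := Set.mem_iUnion.1 hb
    obtain ⟨f, rfl⟩ := range_ramify_subset r s hr
    obtain ⟨g, rfl⟩ := mul_comm s r ▸ range_ramify_subset s r hs
    exact Set.mem_iUnion.2 ⟨r * s, f * g, map_mul _ _ _⟩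
  add_mem' := by
    intro a b ha hb
    obtain ⟨r, hr⟩ := Set.mem_iUnion.1 ha
    obtain ⟨s, hs⟩ := Set.mem_iUnion.1 hb
    obtain ⟨f, rfl⟩ := range_ramify_subset r s hr
    obtain ⟨g, rfl⟩ := mul_comm s r ▸ range_ramify_subset s r hs
    exact Set.mem_iUnion.2 ⟨r * s, f + g, map_add _ _ _⟩
  one_mem' := Set.mem_iUnion.2 ⟨1, 1, map_one _⟩
  zero_mem' := Set.mem_iUnion.2 ⟨1, 0, map_zero _⟩
  neg_mem' := by
    intro a ha
    obtain ⟨r, f, rfl⟩ := Set.mem_iUnion.1 ha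
    exact Set.mem_iUnion.2 ⟨r, -f, map_neg _ _⟩
  inv_mem' := by
    intro a ha
    obtain ⟨r, f, rfl⟩ := Set.mem_iUnion.1 ha
    exact Set.mem_iUnion.2 ⟨r, f⁻¹, map_inv₀ _ _⟩

variable {C}

theorem mem_puiseux_iff (f : HahnSeries ℚ C) :
    f ∈ Puiseux C ↔ ∃ r : ℕ+, f ∈ Set.range (ramify C r) :=
  Set.mem_iUnion (s := fun r : ℕ+ => Set.range (ramify C r))

theorem C_mem_puiseux (c : C) : HahnSeries.C c ∈ Puiseux C :=
  (mem_puiseux_iff _).2 ⟨1, HahnSeries.C c,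
    HahnSeries.embDomainRingHom_C (Γ := ℤ) (Γ' := ℚ) (R := C)⟩

theorem hahnSubst_mem_puiseux (p : ℕ+) {f : HahnSeries ℚ C} (hf : f ∈ Puiseux C) :
    hahnSubst C p f ∈ Puiseux C := by
  obtain ⟨r, hr⟩ := (mem_puiseux_iff f).1 hf
  refine (mem_puiseux_iff _).2 ⟨r, (mem_range_ramify_iff r _).2 fun s hs => ?_⟩
  have hp : ((p : ℕ) : ℚ) ≠ 0 := Nat.cast_ne_zero.2 p.ne_zero
  have hs' : s = ((p : ℕ) : ℚ) * (s / ((p : ℕ) : ℚ)) := by field_simp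
  rw [HahnSeries.mem_support, hs', hahnSubst_coeff_mul] at hs
  obtain ⟨k, hk⟩ := (mem_range_ramify_iff r f).1 hr _ hs
  refine ⟨(p : ℕ) * k, ?_⟩
  rw [hs', ← hk]
  push_cast
  ring

variable (C) in
/-- The Mahler operator `f(x) ↦ f(x^p)` on formal Puiseux series. -/
def mahler (p : ℕ+) : Puiseux C →+* Puiseux C :=
  (hahnSubst C p).restrict (Puiseux C) (Puiseux C) fun _ hf => hahnSubst_mem_puiseux p hf

variable (C) in
/-- The inclusion of the constants into the field of formal Puiseux series. -/
def const : C →+* Puiseux C :=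
  (HahnSeries.C : C →+* HahnSeries ℚ C).codRestrict (Puiseux C) C_mem_puiseux

/-- The entrywise substitution `M(x) ↦ M(x^p)` on invertible matrices. -/
def mahlerGL {n : ℕ} (p : ℕ+) (M : GL (Fin n) (Puiseux C)) : GL (Fin n) (Puiseux C) :=
  Matrix.GeneralLinearGroup.map (mahler C p) M

/-- A constant invertible matrix, regarded as a matrix of Puiseux series. -/
def constGL {n : ℕ} (M : GL (Fin n) C) : GL (Fin n) (Puiseux C) :=
  Matrix.GeneralLinearGroup.map (const C) M

/-- The coefficient matrix `G(x^p)⁻¹ A(x) G(x)` of the system which `y(x^p) = A(x) y(x)` becomes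
under the gauge transformation `y = G(x) z`. -/
def gaugeTransform {n : ℕ} (p : ℕ+) (A G : GL (Fin n) (Puiseux C)) : GL (Fin n) (Puiseux C) :=
  (mahlerGL p G)⁻¹ * A * G

/-- The point `x = 0` is a regular singular point of `y(x^p) = A(x) y(x)`: some gauge
transformation over the Puiseux series makes the coefficient matrix constant. -/
def IsRegularSingularAtZero {n : ℕ} (p : ℕ+) (A : GL (Fin n) (Puiseux C)) : Prop :=
  ∃ (G : GL (Fin n) (Puiseux C)) (A₀ : GL (Fin n) C), gaugeTransform p A G = constGL A₀

/-- The systems `y(x^p) = A(x) y(x)`, `y(x^q) = B(x) y(x)` are consistent. -/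
def IsConsistent {n : ℕ} (p q : ℕ+) (A B : GL (Fin n) (Puiseux C)) : Prop :=
  mahlerGL q A * B = mahlerGL p B * A

/-- There are no nonzero integers `a`, `b` with `p^a = q^b`. -/
def MultiplicativelyIndependent (p q : ℕ+) : Prop :=
  ∀ a b : ℤ, a ≠ 0 → b ≠ 0 → ((p : ℕ) : ℚ) ^ a ≠ ((q : ℕ) : ℚ) ^ b

end MahlerSystem

end

/-!
Write `K` for the field of Puiseux series. The operators `Φ v = A⁻¹ v(x^p)` and
`Ψ v = B⁻¹ v(x^q)` on `K^n` are injective and semilinear with respect to `x ↦ x^p` and `x ↦ x^q`,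
and consistency says that they commute. It suffices to find a basis in which `Φ` has a constant
matrix; by induction on the dimension, both matrices are made constant (`exists_basis_const`).

*A common eigenvector* (`exists_common_eigenvector`). Take the minimal relation
`Φ^(m+1) v = ∑ c_i Φ^i v`. Finding an eigenvector of `Φ` in the span of the `Φ^i v` amounts to one
scalar Mahler equation with a free constant twist. It has a Puiseux solution
(`exists_twisted_solution`): a monomial change of variable given by the Newton polygon makes the
coefficients integral, an algebraic equation over `C` determines the twist, and the coefficients
of the solution follow by recursion, since `x ↦ x^p` multiplies exponents by `p`. Applying the
minimal relation a second time, now to `Ψ` and an eigenvector of `Φ`, gives a relation with constant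
coefficients, because the series invariant under `x ↦ x^p` are the constants.

*Splitting* (`exists_gauge_row`). Modulo the common eigenvector `w` both matrices are constant by
induction. What remains is to make the first rows `a` and `b` constant, that is, to find `g` with
`g_s M = a_s + l g_{s/p}` and `g_s N = b_s + u g_{s/q}` for all exponents `s ≠ 0`. The first
recursion has a unique solution among families of coefficients with bounded denominators,
and by uniqueness it solves the second one (`exists_common_orbit_sum`). Such a `g` could
only fail to be a Puiseux series by having infinitely many negative exponents. The first recursion
puts these into the orbits under multiplication by `p` of the finitely many poles of `a`, and
the second makes the set of negative exponents far from `0` stable under multiplication by `q`.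
For multiplicatively independent `p` and `q` this is impossible.
-/

open scoped LaurentSeries Matrix

noncomputable section

namespace MahlerSystem

variable {C : Type*} [Field C]

/-! ### Coefficients of Puiseux series -/

theorem mahler_coeff (p : ℕ+) (f : Puiseux C) (s : ℚ) :
    (mahler C p f).1.coeff s = f.1.coeff (s / ((p : ℕ) : ℚ)) := by
  have hp : ((p : ℕ) : ℚ) ≠ 0 := Nat.cast_ne_zero.2 p.ne_zero
  have h := hahnSubst_coeff_mul p f.1 (s / ((p : ℕ) : ℚ))
  rwa [mul_div_cancel₀ _ hp] at h

theorem const_coeff_zero (c : C) : (const C c).1.coeff 0 = c :=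
  HahnSeries.coeff_single_same 0 c

theorem const_coeff_of_ne (c : C) {s : ℚ} (hs : s ≠ 0) : (const C c).1.coeff s = 0 :=
  HahnSeries.coeff_single_of_ne hs

theorem const_mul_coeff (c : C) (f : Puiseux C) (s : ℚ) :
    (const C c * f).1.coeff s = c * f.1.coeff s := by
  change (HahnSeries.C c * f.1).coeff s = _
  rw [HahnSeries.C_mul_eq_smul, HahnSeries.coeff_smul, smul_eq_mul]

theorem puiseux_ext {f g : Puiseux C} (h : ∀ s, f.1.coeff s = g.1.coeff s) : f = g :=
  Subtype.ext (HahnSeries.ext (funext h))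

theorem sum_coeff {ι : Type*} (t : Finset ι) (f : ι → Puiseux C) (s : ℚ) :
    (∑ i ∈ t, f i).1.coeff s = ∑ i ∈ t, (f i).1.coeff s := by
  have : (∑ i ∈ t, f i).1 = ∑ i ∈ t, (f i).1 := map_sum (Puiseux C).subtype f t
  rw [this, HahnSeries.coeff_sum]

theorem eq_const_of_coeff_eq_zero {f : Puiseux C} (h : ∀ s, s ≠ 0 → f.1.coeff s = 0) :
    f = const C (f.1.coeff 0) := by
  refine puiseux_ext fun s => ?_
  by_cases hs : s = 0
  · rw [hs, const_coeff_zero]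
  · rw [h s hs, const_coeff_of_ne _ hs]

theorem mahler_const (p : ℕ+) (c : C) : mahler C p (const C c) = const C c := by
  refine puiseux_ext fun s => ?_
  rw [mahler_coeff]
  by_cases hs : s = 0
  · rw [hs, zero_div]
  · have hp : ((p : ℕ) : ℚ) ≠ 0 := Nat.cast_ne_zero.2 p.ne_zero
    rw [const_coeff_of_ne _ hs, const_coeff_of_ne _ (div_ne_zero hs hp)]

/-- A single natural number `N` that controls both the denominators of the exponents (they divide
`N!`) and the order of the pole. The condition is monotone in `N`, so that finitely many series
admit a common `N`. -/
def BoundedBy {α : Type*} [Zero α] (N : ℕ) (f : ℚ → α) : Prop :=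
  ∀ s, f s ≠ 0 → (∃ k : ℤ, (N.factorial : ℚ) * s = k) ∧ -(N : ℚ) ≤ s

theorem BoundedBy.mono {α : Type*} [Zero α] {N N' : ℕ} (h : N ≤ N') {f : ℚ → α} (hf : BoundedBy N f) :
    BoundedBy N' f := by
  intro s hs
  obtain ⟨⟨k, hk⟩, hN⟩ := hf s hs
  obtain ⟨d, hd⟩ := Nat.factorial_dvd_factorial h
  refine ⟨⟨d * k, ?_⟩, ?_⟩
  · rw [hd]
    push_cast
    rw [← hk]
    ring
  · have : (N : ℚ) ≤ N' := Nat.cast_le.2 h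
    linarith

theorem exists_boundedBy (f : Puiseux C) : ∃ N, BoundedBy N f.1.coeff := by
  obtain ⟨r, hr⟩ := (mem_puiseux_iff f.1).1 f.2
  rw [mem_range_ramify_iff] at hr
  obtain ⟨m, hm⟩ := exists_nat_ge (-f.1.order)
  refine ⟨max r m, fun s hs => ⟨?_, ?_⟩⟩
  · obtain ⟨k, rfl⟩ := hr s hs
    obtain ⟨d, hd⟩ := Nat.dvd_factorial r.pos (le_max_left (r : ℕ) m)
    refine ⟨d * k, ?_⟩
    rw [hd]
    have : ((r : ℕ) : ℚ) ≠ 0 := Nat.cast_ne_zero.2 r.ne_zero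
    push_cast
    field_simp
  · have h1 : f.1.order ≤ s := HahnSeries.order_le_of_coeff_ne_zero hs
    have h2 : (m : ℚ) ≤ (max (r : ℕ) m : ℕ) := Nat.cast_le.2 (le_max_right _ _)
    linarith

theorem eventually_boundedBy (f : Puiseux C) :
    ∀ᶠ N in Filter.atTop, BoundedBy N f.1.coeff := by
  obtain ⟨N, hN⟩ := exists_boundedBy f
  exact Filter.eventually_atTop.2 ⟨N, fun _ h => hN.mono h⟩

/-- Coefficient families with bounded denominators and bounded pole come from Puiseux series. -/
theorem exists_puiseux (f : ℚ → C) (r : ℕ) (hr : r ≠ 0) (B : ℚ)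
    (h : ∀ s, f s ≠ 0 → (∃ k : ℤ, (r : ℚ) * s = k) ∧ B ≤ s) :
    ∃ F : Puiseux C, F.1.coeff = f := by
  have hr' : (0 : ℚ) < r := Nat.cast_pos.2 (Nat.pos_of_ne_zero hr)
  have hpwo : (Function.support f).IsPWO := by
    refine Set.IsWF.isPWO (Set.isWF_iff_no_descending_seq.2 ?_)
    intro g hg hmem
    choose k hk using fun n => (h (g n) (hmem n)).1
    have hbdd : BddBelow (Set.range k) := by
      refine ⟨⌊(r : ℚ) * B⌋, ?_⟩
      rintro _ ⟨n, rfl⟩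
      rw [← Int.floor_intCast (R := ℚ) (k n), ← hk]
      exact Int.floor_mono (mul_le_mul_of_nonneg_left (h (g n) (hmem n)).2 hr'.le)
    have hanti : StrictAnti k := fun a b hab => by
      have := mul_lt_mul_of_pos_left (hg hab) hr'
      rw [hk, hk] at this
      exact_mod_cast this
    obtain ⟨n, hn⟩ := Int.csInf_mem (Set.range_nonempty k) hbdd
    have h1 := csInf_le hbdd ⟨n + 1, rfl⟩
    have h2 := hanti (Nat.lt_succ_self n)
    rw [← hn] at h1
    exact absurd h2 (not_lt.2 h1)
  let F : HahnSeries ℚ C := ⟨f, hpwo⟩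
  refine ⟨⟨F, (mem_puiseux_iff F).2 ⟨⟨r, Nat.pos_of_ne_zero hr⟩,
    (mem_range_ramify_iff _ _).2 fun s hs => ?_⟩⟩, rfl⟩
  obtain ⟨k, hk⟩ := (h s hs).1
  exact ⟨k, by rw [← hk]; simp only [PNat.mk_coe]; field_simp⟩

theorem mahler_surjective (p : ℕ+) : Function.Surjective (mahler C p) := by
  intro f
  have hp : (0 : ℚ) < ((p : ℕ) : ℚ) := Nat.cast_pos.2 p.pos
  obtain ⟨N, hN⟩ := exists_boundedBy f
  obtain ⟨F, hF⟩ := exists_puiseux (fun s => f.1.coeff (((p : ℕ) : ℚ) * s)) (N.factorial * p)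
    (mul_ne_zero N.factorial_ne_zero p.ne_zero) (-N / ((p : ℕ) : ℚ)) (fun s hs => by
      obtain ⟨⟨k, hk⟩, h2⟩ := hN _ hs
      refine ⟨⟨k, ?_⟩, ?_⟩
      · rw [← hk]
        push_cast
        ring
      · rw [div_le_iff₀ hp, mul_comm]
        exact h2)
  refine ⟨F, puiseux_ext fun s => ?_⟩
  rw [mahler_coeff, hF]
  simp only
  rw [mul_div_cancel₀ _ hp.ne']

/-- A nonzero integer is not divisible by arbitrarily high powers of `p`. -/
theorem not_int_div_pow {p : ℕ+} (hp : 2 ≤ p) {r : ℕ} (hr : r ≠ 0) {s : ℚ} (hs : s ≠ 0) :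
    ∃ k₀ : ℕ, ∀ k, k₀ ≤ k → ¬ ∃ n : ℤ, (r : ℚ) * (s / ((p : ℕ) : ℚ) ^ k) = n := by
  have hp' : 2 ≤ (p : ℕ) := hp
  have hr' : (r : ℚ) ≠ 0 := Nat.cast_ne_zero.2 hr
  obtain ⟨m, hm⟩ := exists_nat_gt |(r : ℚ) * s|
  refine ⟨m, ?_⟩
  rintro k hk ⟨n, hn⟩
  have hpk : (0 : ℚ) < ((p : ℕ) : ℚ) ^ k := pow_pos (Nat.cast_pos.2 p.pos) k
  have h1 : (r : ℚ) * s = n * ((p : ℕ) : ℚ) ^ k := by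
    rw [← hn]
    field_simp
  have hn0 : n ≠ 0 := by
    rintro rfl
    rw [Int.cast_zero, zero_mul] at h1
    exact mul_ne_zero hr' hs h1
  have h2 : (1 : ℚ) ≤ |(n : ℚ)| := by exact_mod_cast Int.one_le_abs hn0
  have h3 : (k : ℚ) < ((p : ℕ) : ℚ) ^ k := by exact_mod_cast Nat.lt_pow_self hp'
  have h4 : (m : ℚ) ≤ k := Nat.cast_le.2 hk
  rw [h1, abs_mul, abs_of_pos hpk] at hm
  nlinarith

/-- The series fixed by the Mahler operator are the constants: the support is stable under
`s ↦ s / p`, while its denominators are bounded. -/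
theorem exists_eq_const_of_mahler_eq {p : ℕ+} (hp : 2 ≤ p) {f : Puiseux C}
    (hf : mahler C p f = f) : ∃ c, f = const C c := by
  refine ⟨_, eq_const_of_coeff_eq_zero fun s hs => ?_⟩
  have hk : ∀ k : ℕ, f.1.coeff s = f.1.coeff (s / ((p : ℕ) : ℚ) ^ k) := by
    intro k
    induction k with
    | zero => simp
    | succ k ih => rw [ih, pow_succ, ← div_div, ← mahler_coeff, hf]
  obtain ⟨N, hN⟩ := exists_boundedBy f
  obtain ⟨k, hk0⟩ := not_int_div_pow hp N.factorial_ne_zero hs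
  by_contra h
  rw [hk k] at h
  exact hk0 k le_rfl (hN _ h).1

/-! ### Solving scalar Mahler equations -/

theorem mahler_iterate_coeff (p : ℕ+) (j : ℕ) (f : Puiseux C) (s : ℚ) :
    ((mahler C p)^[j] f).1.coeff s = f.1.coeff (s / ((p : ℕ) : ℚ) ^ j) := by
  induction j generalizing s with
  | zero => simp
  | succ j ih => rw [Function.iterate_succ_apply', mahler_coeff, ih, div_div, ← pow_succ']

/-- The constant terms of a scalar Mahler equation can be balanced by a twist `σ`. -/
theorem exists_sum_pow_mul_eq_one [IsAlgClosed C] (m : ℕ) (γ : ℕ → C)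
    (h : ∃ j ∈ Finset.range (m + 1), γ j ≠ 0) :
    ∃ σ : C, σ ≠ 0 ∧ ∑ j ∈ Finset.range (m + 1), σ ^ (j + 1) * γ j = 1 := by
  classical
  obtain ⟨j, hj, hγ⟩ := h
  let P : Polynomial C :=
    ∑ i ∈ Finset.range (m + 1), Polynomial.X ^ (i + 1) * Polynomial.C (γ i) - Polynomial.C 1
  have hcoeff : P.coeff (j + 1) = γ j := by
    have h1 : ∀ i, (Polynomial.X ^ (i + 1) * Polynomial.C (γ i)).coeff (j + 1) =
        if j = i then γ i else 0 := fun i => by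
      rw [Polynomial.coeff_mul_C, Polynomial.coeff_X_pow]
      simp
    simp only [P, Polynomial.coeff_sub, Polynomial.finsetSum_coeff, h1, Finset.sum_ite_eq,
      if_pos hj, Polynomial.coeff_C_succ, sub_zero]
  have hdeg : P.degree ≠ 0 := fun h0 => by
    have := Polynomial.coeff_eq_zero_of_degree_lt (p := P) (n := j + 1) (by
      rw [h0]
      exact_mod_cast Nat.succ_pos j)
    exact hγ (hcoeff ▸ this)
  obtain ⟨σ, hσ⟩ := IsAlgClosed.exists_root P hdeg
  have hsum : ∑ i ∈ Finset.range (m + 1), σ ^ (i + 1) * γ i = 1 := by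
    have := hσ
    simp only [P, Polynomial.IsRoot, Polynomial.eval_sub, Polynomial.eval_finsetSum,
      Polynomial.eval_mul, Polynomial.eval_pow, Polynomial.eval_X, Polynomial.eval_C] at this
    exact sub_eq_zero.1 this
  refine ⟨σ, ?_, hsum⟩
  rintro rfl
  simp at hsum

/-- A sequence can be defined by an equation `Y n = T Y n` whose right-hand side only
involves the terms of index `< n`. -/
theorem exists_causal_fixedPoint {α : Type*} [Nonempty α] (T : (ℕ → α) → ℕ → α)
    (hT : ∀ Y Y' n, (∀ i < n, Y i = Y' i) → T Y n = T Y' n) : ∃ Y, ∀ n, Y n = T Y n := by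
  have := Classical.inhabited_of_nonempty ‹Nonempty α›
  let Y : ℕ → α := fun n => Nat.strongRec
    (fun n ih => T (fun i => if h : i < n then ih i h else default) n) n
  refine ⟨Y, fun n => ?_⟩
  have h : Y n = T (fun i => if _ : i < n then Y i else default) n := by
    simp only [Y]
    rw [Nat.strongRec_eq]
  rw [h]
  exact hT _ _ _ fun i hi => dif_pos hi

theorem exists_powerSeries_solution [IsAlgClosed C] {p : ℕ+} (hp : 2 ≤ p) (m : ℕ)
    (d : ℕ → PowerSeries C)
    (h : ∃ j ∈ Finset.range (m + 1), PowerSeries.coeff 0 (d j) ≠ 0) :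
    ∃ σ : C, σ ≠ 0 ∧ ∃ Y : PowerSeries C, Y ≠ 0 ∧
      Y = ∑ j ∈ Finset.range (m + 1),
        PowerSeries.C (σ ^ (j + 1)) *
          (d j * PowerSeries.expand ((p : ℕ) ^ (j + 1)) (pow_ne_zero _ p.ne_zero) Y) := by
  obtain ⟨σ, hσ, hsum⟩ := exists_sum_pow_mul_eq_one m (fun j => PowerSeries.coeff 0 (d j)) h
  let S : (ℕ → C) → PowerSeries C := fun y => ∑ j ∈ Finset.range (m + 1),
    PowerSeries.C (σ ^ (j + 1)) *
      (d j * PowerSeries.expand ((p : ℕ) ^ (j + 1)) (pow_ne_zero _ p.ne_zero) (PowerSeries.mk y))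
  obtain ⟨y, hy⟩ := exists_causal_fixedPoint
    -- At `n = 0` the choice of `σ` leaves the value free, and it is normalized to `1`.
    (fun y n => if n = 0 then (1 : C) else PowerSeries.coeff n (S y)) (by
      intro y y' n hyy
      split_ifs with hn
      · rfl
      · simp only [S, map_sum, PowerSeries.coeff_C_mul]
        simp only [PowerSeries.coeff_mul, PowerSeries.coeff_expand,
          PowerSeries.coeff_mk]
        refine Finset.sum_congr rfl fun j _ => ?_
        congr 1
        refine Finset.sum_congr rfl fun x hx => ?_
        have hx' : x.2 ≤ n := by
          have := Finset.HasAntidiagonal.mem_antidiagonal.1 hx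
          omega
        have hpj : 1 < (p : ℕ) ^ (j + 1) := Nat.one_lt_pow (Nat.succ_ne_zero j) hp
        have hlt : x.2 / (p : ℕ) ^ (j + 1) < n :=
          (Nat.div_le_div_right hx').trans_lt (Nat.div_lt_self (Nat.pos_of_ne_zero hn) hpj)
        rw [hyy _ hlt])
  have hy0 : y 0 = 1 := by simpa using hy 0
  refine ⟨σ, hσ, PowerSeries.mk y, fun h0 => ?_, ?_⟩
  · have := congrArg (PowerSeries.coeff 0) h0
    rw [PowerSeries.coeff_mk, hy0] at this
    exact one_ne_zero this
  · ext n
    rw [PowerSeries.coeff_mk]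
    by_cases hn : n = 0
    · subst hn
      rw [hy0, ← hsum]
      have hc : PowerSeries.constantCoeff (PowerSeries.mk y) = 1 := by
        rw [← PowerSeries.coeff_zero_eq_constantCoeff_apply, PowerSeries.coeff_mk, hy0]
      simp only [PowerSeries.coeff_zero_eq_constantCoeff_apply, map_sum, map_mul,
        PowerSeries.constantCoeff_C, PowerSeries.constantCoeff_expand, hc, mul_one]
    · rw [hy n, if_neg hn]

/-- The power series in `x ^ (1 / r)` as Puiseux series. -/
def ofPowerSeries (r : ℕ+) : PowerSeries C →+* Puiseux C :=
  ((ramify C r).comp (HahnSeries.ofPowerSeries ℤ C)).codRestrict (Puiseux C)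
    fun _ => (mem_puiseux_iff _).2 ⟨r, _, rfl⟩

theorem ofPowerSeries_coeff_mul_inv (r : ℕ+) (Y : PowerSeries C) (n : ℕ) :
    (ofPowerSeries r Y).1.coeff ((n : ℚ) * ((r : ℕ) : ℚ)⁻¹) = PowerSeries.coeff n Y := by
  have h := ramify_coeff_mul_inv r (HahnSeries.ofPowerSeries ℤ C Y) n
  rw [Int.cast_natCast] at h
  exact h.trans (HahnSeries.ofPowerSeries_apply_coeff Y n)

theorem ofPowerSeries_coeff_eq_zero (r : ℕ+) (Y : PowerSeries C) (s : ℚ)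
    (h : ∀ n : ℕ, (n : ℚ) * ((r : ℕ) : ℚ)⁻¹ ≠ s) : (ofPowerSeries r Y).1.coeff s = 0 := by
  change (ramify C r _).coeff s = 0
  by_cases hs : ∃ k : ℤ, (k : ℚ) * ((r : ℕ) : ℚ)⁻¹ = s
  · obtain ⟨k, rfl⟩ := hs
    rw [ramify_coeff_mul_inv, HahnSeries.ofPowerSeries_apply]
    refine HahnSeries.embDomain_of_notMem_range ?_
    rintro ⟨n, hn⟩
    refine h n ?_
    have : (n : ℤ) = k := hn
    rw [← this, Int.cast_natCast]
  · exact ramify_coeff_eq_zero r _ s (by simpa using hs)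

theorem ofPowerSeries_injective (r : ℕ+) :
    Function.Injective (ofPowerSeries r : PowerSeries C →+* Puiseux C) := by
  intro Y Y' h
  ext n
  rw [← ofPowerSeries_coeff_mul_inv r, h, ofPowerSeries_coeff_mul_inv]

theorem ofPowerSeries_C (r : ℕ+) (c : C) : ofPowerSeries r (PowerSeries.C c) = const C c := by
  refine Subtype.ext ?_
  change ramify C r (HahnSeries.ofPowerSeries ℤ C (PowerSeries.C c)) = HahnSeries.C c
  rw [HahnSeries.ofPowerSeries_C]
  exact HahnSeries.embDomainRingHom_C (Γ := ℤ) (Γ' := ℚ) (R := C)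

theorem mahler_iterate_ofPowerSeries (p r : ℕ+) (j : ℕ) (Y : PowerSeries C) :
    (mahler C p)^[j] (ofPowerSeries r Y) =
      ofPowerSeries r (PowerSeries.expand ((p : ℕ) ^ j) (pow_ne_zero _ p.ne_zero) Y) := by
  have hr : ((r : ℕ) : ℚ) ≠ 0 := Nat.cast_ne_zero.2 r.ne_zero
  have hp : ((p : ℕ) : ℚ) ^ j ≠ 0 := pow_ne_zero _ (Nat.cast_ne_zero.2 p.ne_zero)
  refine puiseux_ext fun s => ?_
  rw [mahler_iterate_coeff]
  by_cases hs : ∃ n : ℕ, (n : ℚ) * ((r : ℕ) : ℚ)⁻¹ = s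
  · obtain ⟨n, rfl⟩ := hs
    rw [ofPowerSeries_coeff_mul_inv, PowerSeries.coeff_expand]
    split_ifs with hd
    · obtain ⟨l, rfl⟩ := hd
      rw [Nat.mul_div_cancel_left _ (pow_pos p.pos j), ← ofPowerSeries_coeff_mul_inv r]
      congr 1
      push_cast
      field_simp
    · refine ofPowerSeries_coeff_eq_zero r _ _ fun l hl => hd ⟨l, ?_⟩
      field_simp at hl
      have h2 : ((p : ℕ) : ℚ) ^ j * l = n := by linear_combination hl
      exact_mod_cast h2.symm
  · rw [ofPowerSeries_coeff_eq_zero r _ s (by simpa using hs)]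
    refine ofPowerSeries_coeff_eq_zero r _ _ fun l hl => hs ⟨(p : ℕ) ^ j * l, ?_⟩
    rw [eq_div_iff hp] at hl
    rw [← hl]
    push_cast
    ring

/-- A Puiseux series with nonnegative exponents is a power series in some `x ^ (1 / N!)`. -/
theorem exists_ofPowerSeries_eq {N : ℕ} {r : ℕ+} (hrN : (r : ℕ) = N.factorial) {f : Puiseux C}
    (hN : BoundedBy N f.1.coeff) (h : ∀ s < 0, f.1.coeff s = 0) :
    ∃ Y : PowerSeries C, ofPowerSeries r Y = f := by
  refine ⟨PowerSeries.mk fun n => f.1.coeff ((n : ℚ) * ((r : ℕ) : ℚ)⁻¹),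
    puiseux_ext fun s => ?_⟩
  have hr : ((r : ℕ) : ℚ) ≠ 0 := Nat.cast_ne_zero.2 r.ne_zero
  by_cases hs : ∃ n : ℕ, (n : ℚ) * ((r : ℕ) : ℚ)⁻¹ = s
  · obtain ⟨n, rfl⟩ := hs
    rw [ofPowerSeries_coeff_mul_inv, PowerSeries.coeff_mk]
  · rw [ofPowerSeries_coeff_eq_zero _ _ s (by simpa using hs)]
    by_contra hne
    obtain ⟨⟨k, hk⟩, -⟩ := hN s (fun h0 => hne h0.symm)
    rw [← hrN] at hk
    have hs0 : 0 ≤ s := not_lt.1 fun hlt => hne (h s hlt).symm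
    have hk0 : 0 ≤ k := by
      have : (0 : ℚ) ≤ k := by
        rw [← hk]
        positivity
      exact_mod_cast this
    lift k to ℕ using hk0
    refine hs ⟨k, ?_⟩
    rw [Int.cast_natCast] at hk
    rw [← hk]
    field_simp

/-- The monomial `x ^ μ`. -/
def monomial (μ : ℚ) : Puiseux C :=
  ⟨HahnSeries.single μ 1, by
    refine (mem_puiseux_iff _).2 ⟨⟨μ.den, μ.den_pos⟩, (mem_range_ramify_iff _ _).2 fun s hs => ?_⟩
    rw [HahnSeries.eq_of_mem_support_single hs]
    exact ⟨μ.num, by simpa [div_eq_mul_inv] using Rat.num_div_den μ⟩⟩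

theorem monomial_mul_coeff (μ : ℚ) (f : Puiseux C) (s : ℚ) :
    (monomial μ * f).1.coeff s = f.1.coeff (s - μ) := by
  have h := HahnSeries.coeff_single_mul_add (r := (1 : C)) (x := f.1) (a := s - μ) (b := μ)
  rw [sub_add_cancel, one_mul] at h
  exact h

theorem monomial_mul_monomial (μ ν : ℚ) :
    (monomial μ * monomial ν : Puiseux C) = monomial (μ + ν) :=
  Subtype.ext (by
    change HahnSeries.single μ (1 : C) * HahnSeries.single ν 1 = HahnSeries.single (μ + ν) 1
    rw [HahnSeries.single_mul_single, one_mul])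

theorem monomial_ne_zero (μ : ℚ) : (monomial μ : Puiseux C) ≠ 0 := fun h => by
  have := congrArg (fun f : Puiseux C => f.1.coeff μ) h
  exact one_ne_zero ((HahnSeries.coeff_single_same μ (1 : C)).symm.trans this)

theorem mahler_iterate_monomial (p : ℕ+) (j : ℕ) (μ : ℚ) :
    (mahler C p)^[j] (monomial μ) = monomial (((p : ℕ) : ℚ) ^ j * μ) := by
  have hp : ((p : ℕ) : ℚ) ^ j ≠ 0 := pow_ne_zero _ (Nat.cast_ne_zero.2 p.ne_zero)
  refine puiseux_ext fun s => ?_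
  rw [mahler_iterate_coeff]
  simp only [monomial, HahnSeries.coeff_single]
  congr 1
  rw [div_eq_iff hp, mul_comm]

/-- A homogeneous scalar Mahler equation with constant term `1` has a nonzero Puiseux solution
up to a twist of the Mahler operator by a constant `σ`. After the substitution `z = x ^ μ y`,
where `-μ` is the first slope of the Newton polygon, the coefficients are integral and not all of
them vanish at `x = 0`; then `σ` is determined by the constant terms, and the
coefficients of `y` by recursion. -/
theorem exists_twisted_solution [IsAlgClosed C] {p : ℕ+} (hp : 2 ≤ p) (m : ℕ)
    (D : ℕ → Puiseux C) (h : ∃ j ∈ Finset.range (m + 1), D j ≠ 0) :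
    ∃ σ : C, σ ≠ 0 ∧ ∃ z : Puiseux C, z ≠ 0 ∧
      z = ∑ j ∈ Finset.range (m + 1),
        const C (σ ^ (j + 1)) * (D j * (mahler C p)^[j + 1] z) := by
  classical
  have hp' : (2 : ℚ) ≤ ((p : ℕ) : ℚ) := by exact_mod_cast hp
  have hpj : ∀ j : ℕ, (0 : ℚ) < ((p : ℕ) : ℚ) ^ (j + 1) - 1 := fun j =>
    sub_pos.2 (one_lt_pow₀ (by linarith) (Nat.succ_ne_zero j))
  obtain ⟨j₀, hj₀, hmax⟩ := Finset.exists_max_image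
    ((Finset.range (m + 1)).filter fun j => D j ≠ 0)
    (fun j => -(D j).1.order / (((p : ℕ) : ℚ) ^ (j + 1) - 1))
    (by
      obtain ⟨j, hj, hD⟩ := h
      exact ⟨j, Finset.mem_filter.2 ⟨hj, hD⟩⟩)
  rw [Finset.mem_filter] at hj₀
  set μ : ℚ := -(D j₀).1.order / (((p : ℕ) : ℚ) ^ (j₀ + 1) - 1) with hμ
  let E : ℕ → Puiseux C := fun j => monomial (μ * (((p : ℕ) : ℚ) ^ (j + 1) - 1)) * D j
  have hE0 : ∀ j ∈ Finset.range (m + 1), ∀ s < 0, (E j).1.coeff s = 0 := by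
    intro j hj s hs
    rw [monomial_mul_coeff]
    by_cases hD : D j = 0
    · rw [hD]
      rfl
    · refine HahnSeries.coeff_eq_zero_of_lt_order ?_
      have := hmax j (Finset.mem_filter.2 ⟨hj, hD⟩)
      rw [div_le_iff₀ (hpj j)] at this
      linarith
  have hEj₀ : (E j₀).1.coeff 0 ≠ 0 := by
    rw [monomial_mul_coeff, hμ, div_mul_cancel₀ _ (hpj j₀).ne', zero_sub, neg_neg]
    exact HahnSeries.coeff_order_eq_zero.not.2 fun h0 => hj₀.2 (Subtype.ext h0)
  obtain ⟨N, hN⟩ := ((Filter.eventually_all_finset (Finset.range (m + 1))).2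
    fun j _ => eventually_boundedBy (E j)).exists
  obtain ⟨r, hr⟩ : ∃ r : ℕ+, (r : ℕ) = N.factorial := ⟨⟨_, N.factorial_pos⟩, rfl⟩
  choose! d hd using fun j (hj : j ∈ Finset.range (m + 1)) =>
    exists_ofPowerSeries_eq hr (hN j hj) (hE0 j hj)
  obtain ⟨σ, hσ, Y, hY0, hY⟩ := exists_powerSeries_solution hp m d ⟨j₀, hj₀.1, by
    have := ofPowerSeries_coeff_mul_inv r (d j₀) 0
    rw [hd j₀ hj₀.1, Nat.cast_zero, zero_mul] at this
    rwa [← this]⟩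
  refine ⟨σ, hσ, monomial μ * ofPowerSeries r Y, mul_ne_zero (monomial_ne_zero μ)
    ((map_ne_zero_iff _ (ofPowerSeries_injective r)).2 hY0), ?_⟩
  have hY' := congrArg (ofPowerSeries r) hY
  rw [map_sum] at hY'
  conv_lhs => rw [hY', Finset.mul_sum]
  refine Finset.sum_congr rfl fun j hj => ?_
  rw [map_mul, map_mul, ofPowerSeries_C, hd j hj, ← mahler_iterate_ofPowerSeries,
    iterate_map_mul, mahler_iterate_monomial]
  have hmon : (monomial (((p : ℕ) : ℚ) ^ (j + 1) * μ) : Puiseux C) =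
      monomial μ * monomial (μ * (((p : ℕ) : ℚ) ^ (j + 1) - 1)) := by
    rw [monomial_mul_monomial]
    congr 1
    ring
  rw [hmon]
  simp only [E]
  ring

/-! ### Eigenvectors of semilinear maps -/

section Semilinear

variable {K V : Type*} [Field K] [AddCommGroup V] [Module K V] {φ : K →+* K}

theorem exists_minimal_relation [Module.Finite K V] (Φ : V →ₛₗ[φ] V) {v : V} (hv : v ≠ 0) :
    ∃ (m : ℕ) (c : ℕ → K), LinearIndependent K (fun i : Fin (m + 1) => Φ^[i] v) ∧
      Φ^[m + 1] v = ∑ i ∈ Finset.range (m + 1), c i • Φ^[i] v := by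
  classical
  have hex : ∃ n, ¬ LinearIndependent K (fun i : Fin n => Φ^[i] v) := by
    refine ⟨Module.finrank K V + 1, fun h => ?_⟩
    have := h.fintype_card_le_finrank
    rw [Fintype.card_fin] at this
    omega
  have hspec := Nat.find_spec hex
  have hmin := fun n => Nat.find_min (m := n) hex
  generalize Nat.find hex = n at hspec hmin
  obtain _ | _ | m := n
  · exact absurd (linearIndependent_empty_type) hspec
  · exact absurd (LinearIndependent.of_subsingleton (v := fun i : Fin 1 => Φ^[i] v) 0 hv) hspec
  · have hLI := not_not.1 (hmin (m + 1) (Nat.lt_succ_self _))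
    rw [linearIndependent_finSucc'] at hspec
    have hmem : Φ^[m + 1] v ∈ Submodule.span K (Set.range fun i : Fin (m + 1) => Φ^[i] v) := by
      by_contra hnot
      exact hspec ⟨hLI, hnot⟩
    obtain ⟨c, hc⟩ := (Submodule.mem_span_range_iff_exists_fun K).1 hmem
    refine ⟨m, fun i => if h : i < m + 1 then c ⟨i, h⟩ else 0, hLI, ?_⟩
    rw [← hc, Finset.sum_range]
    exact Finset.sum_congr rfl fun i _ => by simp only [dif_pos i.2]

/-- Given a relation `Φ^(m+1) v = ∑ c_i Φ^i v`, the vector `w = ∑ W_i Φ^i v` satisfies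
`σ Φ w = w` as soon as `W_0 = σ φ(z) c_0`, `W_{i+1} = σ (φ(W_i) + φ(z) c_{i+1})` and `W_m = z`.
Eliminating the other unknowns leaves a scalar equation for `z` alone. The subring `F` keeps
track of where the coefficients `W_i` lie. -/
theorem exists_eigenvector_of_relation (Φ : V →ₛₗ[φ] V) {v : V} {m : ℕ} {c : ℕ → K}
    (hLI : LinearIndependent K (fun i : Fin (m + 1) => Φ^[i] v))
    (hc : Φ^[m + 1] v = ∑ i ∈ Finset.range (m + 1), c i • Φ^[i] v)
    {σ z : K} (hσ : φ σ = σ) (hz : z ≠ 0)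
    (h : z = ∑ j ∈ Finset.range (m + 1), σ ^ (j + 1) * (φ^[j] (c (m - j)) * φ^[j + 1] z))
    (F : Subring K) (hF : ∀ x ∈ F, φ x ∈ F) (hcF : ∀ i ≤ m, c i ∈ F) (hσF : σ ∈ F)
    (hzF : z ∈ F) :
    ∃ W : ℕ → K, (∀ i ≤ m, W i ∈ F) ∧ ∑ i ∈ Finset.range (m + 1), W i • Φ^[i] v ≠ 0 ∧
      σ • Φ (∑ i ∈ Finset.range (m + 1), W i • Φ^[i] v) =
        ∑ i ∈ Finset.range (m + 1), W i • Φ^[i] v := by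
  let W : ℕ → K := fun i =>
    ∑ j ∈ Finset.range (i + 1), σ ^ (j + 1) * (φ^[j] (c (i - j)) * φ^[j + 1] z)
  have hW0 : W 0 = σ * (φ z * c 0) := by
    simp only [W, zero_add, Finset.sum_range_one, Nat.sub_zero, pow_one, Function.iterate_zero,
      id, Function.iterate_one]
    ring
  have hWs : ∀ i, W (i + 1) = σ * (φ (W i) + φ z * c (i + 1)) := by
    intro i
    simp only [W]
    rw [Finset.sum_range_succ', map_sum, mul_add, Finset.mul_sum]
    congr 1
    · refine Finset.sum_congr rfl fun j _ => ?_
      rw [map_mul, map_mul, map_pow, hσ, Nat.add_sub_add_right, Function.iterate_succ_apply',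
        Function.iterate_succ_apply' _ (j + 1)]
      ring
    · simp only [zero_add, Nat.sub_zero, pow_one, Function.iterate_zero, id,
        Function.iterate_one]
      ring
  have hWm : W m = z := h.symm
  have hiter : ∀ (j : ℕ), ∀ x ∈ F, φ^[j] x ∈ F := by
    intro j
    induction j with
    | zero => exact fun x hx => hx
    | succ j ih =>
      intro x hx
      rw [Function.iterate_succ_apply']
      exact hF _ (ih x hx)
  refine ⟨W, fun i hi => ?_, fun h0 => ?_, ?_⟩
  · exact sum_mem fun j _ => mul_mem (pow_mem hσF _)
      (mul_mem (hiter _ _ (hcF _ ((Nat.sub_le _ _).trans hi))) (hiter _ _ hzF))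
  · rw [Finset.sum_range] at h0
    have := Fintype.linearIndependent_iff.1 hLI (fun i => W i) h0 (Fin.last m)
    exact hz (hWm ▸ this)
  · rw [map_sum]
    have h1 : ∀ i, Φ (W i • Φ^[i] v) = φ (W i) • Φ^[i + 1] v := fun i => by
      rw [LinearMap.map_smulₛₗ, Function.iterate_succ_apply']
    simp only [h1]
    rw [Finset.sum_range_succ, hWm, hc, Finset.sum_range_succ' (fun i => W i • Φ^[i] v), hW0,
      Finset.sum_range_succ' (fun i => c i • Φ^[i] v)]
    simp only [hWs]
    simp only [smul_add, Finset.smul_sum, smul_smul, mul_add, add_smul, Finset.sum_add_distrib]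
    abel

end Semilinear

theorem exists_eigenvector [IsAlgClosed C] {p : ℕ+} (hp : 2 ≤ p) {V : Type*} [AddCommGroup V]
    [Module (Puiseux C) V] [Module.Finite (Puiseux C) V] [Nontrivial V]
    (Φ : V →ₛₗ[mahler C p] V) (hΦ : Function.Injective Φ) :
    ∃ (w : V) (l : C), w ≠ 0 ∧ l ≠ 0 ∧ Φ w = const C l • w := by
  obtain ⟨v, hv⟩ := exists_ne (0 : V)
  obtain ⟨m, c, hLI, hc⟩ := exists_minimal_relation Φ hv
  have hne : Φ^[m + 1] v ≠ 0 := fun h0 =>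
    hv (hΦ.iterate (m + 1) (h0.trans (iterate_map_zero Φ (m + 1)).symm))
  obtain ⟨i, hi, hci⟩ : ∃ i ∈ Finset.range (m + 1), c i ≠ 0 := by
    by_contra! h0
    exact hne (hc.trans (Finset.sum_eq_zero fun i hi => by rw [h0 i hi, zero_smul]))
  have him : i ≤ m := Nat.lt_succ_iff.1 (Finset.mem_range.1 hi)
  obtain ⟨σ, hσ, z, hz, h⟩ := exists_twisted_solution hp m
    (fun j => (mahler C p)^[j] (c (m - j)))
    ⟨m - i, Finset.mem_range.2 (by omega), fun h0 => hci (by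
      rw [Nat.sub_sub_self him] at h0
      exact (mahler C p).injective.iterate (m - i) (h0.trans (iterate_map_zero _ _).symm))⟩
  simp only [map_pow] at h
  obtain ⟨W, -, hw, hΦw⟩ := exists_eigenvector_of_relation Φ hLI hc (mahler_const p σ) hz h ⊤
    (fun _ _ => Subring.mem_top _) (fun _ _ => Subring.mem_top _) (Subring.mem_top _)
    (Subring.mem_top _)
  refine ⟨_, σ⁻¹, hw, inv_ne_zero hσ, ?_⟩
  rw [map_inv₀, eq_inv_smul_iff₀ ((map_ne_zero (const C)).2 hσ)]
  exact hΦw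

/-- Commuting Mahler module structures share an eigenvector: starting from an eigenvector `v`
of `Φ`, the minimal relation among the `Ψ^i v` has constant coefficients, because `Φ` maps it to a
proportional relation. -/
theorem exists_common_eigenvector [IsAlgClosed C] {p q : ℕ+} (hp : 2 ≤ p) {V : Type*}
    [AddCommGroup V] [Module (Puiseux C) V] [Module.Finite (Puiseux C) V] [Nontrivial V]
    (Φ : V →ₛₗ[mahler C p] V) (Ψ : V →ₛₗ[mahler C q] V) (hΦ : Function.Injective Φ)
    (hΨ : Function.Injective Ψ) (hcomm : ∀ v, Φ (Ψ v) = Ψ (Φ v)) :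
    ∃ (w : V) (l u : C), w ≠ 0 ∧ l ≠ 0 ∧ u ≠ 0 ∧ Φ w = const C l • w ∧ Ψ w = const C u • w := by
  obtain ⟨v, l, hv, hl, hΦv⟩ := exists_eigenvector hp Φ hΦ
  obtain ⟨m, c, hLI, hc⟩ := exists_minimal_relation Ψ hv
  have hl' : const C l ≠ 0 := (map_ne_zero (const C)).2 hl
  have hΦi : ∀ i, Φ (Ψ^[i] v) = const C l • Ψ^[i] v := by
    intro i
    induction i with
    | zero => exact hΦv
    | succ i ih =>
      rw [Function.iterate_succ_apply', hcomm, ih, LinearMap.map_smulₛₗ, mahler_const]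
  have hfix : ∀ i ≤ m, mahler C p (c i) = c i := by
    have h1 := congrArg Φ hc
    rw [hΦi, map_sum, hc, Finset.smul_sum] at h1
    simp only [LinearMap.map_smulₛₗ, hΦi] at h1
    have h2 : ∑ i ∈ Finset.range (m + 1),
        ((const C l) * (mahler C p (c i) - c i)) • Ψ^[i] v = 0 := by
      rw [← sub_eq_zero.2 h1.symm, ← Finset.sum_sub_distrib]
      refine Finset.sum_congr rfl fun i _ => ?_
      rw [smul_smul, smul_smul, ← sub_smul]
      congr 1
      ring
    rw [Finset.sum_range] at h2
    intro i hi
    have h3 := Fintype.linearIndependent_iff.1 hLI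
      (fun i => (const C l) * (mahler C p (c i) - c i)) h2 ⟨i, Nat.lt_succ_iff.2 hi⟩
    exact sub_eq_zero.1 ((mul_eq_zero.1 h3).resolve_left hl')
  choose! γ hγ using fun i (hi : i ≤ m) => exists_eq_const_of_mahler_eq hp (hfix i hi)
  have hne : Ψ^[m + 1] v ≠ 0 := fun h0 =>
    hv (hΨ.iterate (m + 1) (h0.trans (iterate_map_zero Ψ (m + 1)).symm))
  obtain ⟨i, hi, hγi⟩ : ∃ i ∈ Finset.range (m + 1), γ i ≠ 0 := by
    by_contra! h0
    refine hne (hc.trans (Finset.sum_eq_zero fun i hi => ?_))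
    rw [hγ i (Nat.lt_succ_iff.1 (Finset.mem_range.1 hi)), h0 i hi, map_zero, zero_smul]
  have him : i ≤ m := Nat.lt_succ_iff.1 (Finset.mem_range.1 hi)
  obtain ⟨σ, hσ, hsum⟩ := exists_sum_pow_mul_eq_one m (fun j => γ (m - j))
    ⟨m - i, Finset.mem_range.2 (by omega), by rwa [Nat.sub_sub_self him]⟩
  have hiter : ∀ (j : ℕ) (a : C), (mahler C q)^[j] (const C a) = const C a := fun j a =>
    Function.iterate_fixed (mahler_const q a) j
  obtain ⟨W, hWF, hw, hΨw⟩ := exists_eigenvector_of_relation Ψ hLI hc (mahler_const q σ)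
    one_ne_zero (z := 1) (by
      rw [← map_one (const C)]
      conv_lhs => rw [← hsum, map_sum]
      refine Finset.sum_congr rfl fun j _ => ?_
      rw [hγ _ (Nat.sub_le m j), hiter, hiter, map_mul, map_pow, map_one, mul_one])
    (const C).range
    (by
      rintro _ ⟨a, rfl⟩
      exact ⟨a, (mahler_const q a).symm⟩)
    (fun i hi => ⟨γ i, (hγ i hi).symm⟩) ⟨σ, rfl⟩ (one_mem _)
  refine ⟨_, l, σ⁻¹, hw, hl, inv_ne_zero hσ, ?_, ?_⟩
  · rw [map_sum, Finset.smul_sum]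
    refine Finset.sum_congr rfl fun i hi => ?_
    obtain ⟨a, ha⟩ := hWF i (Nat.lt_succ_iff.1 (Finset.mem_range.1 hi))
    rw [LinearMap.map_smulₛₗ, hΦi, ← ha, mahler_const, smul_comm]
  · rw [map_inv₀, eq_inv_smul_iff₀ ((map_ne_zero (const C)).2 hσ)]
    exact hΨw

/-! ### Splitting extensions by a rank one module -/

/-- The recursion `g s = a s + T (g (s / p))` for `s ≠ 0` is solved by
`g s = ∑ₖ T^k (a (s / p^k))`, a finite sum because the denominators of the support of `a` are
bounded. -/
theorem exists_orbit_sum {p : ℕ+} (hp : 2 ≤ p) {U : Type*} [AddCommGroup U] (T : U →+ U) {r : ℕ}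
    (hr : r ≠ 0) (a : ℚ → U) (ha : ∀ s, a s ≠ 0 → ∃ k : ℤ, (r : ℚ) * s = k) :
    ∃ g : ℚ → U, (∀ s, s ≠ 0 → g s = a s + T (g (s / ((p : ℕ) : ℚ)))) ∧
      ∀ s, g s ≠ 0 → ∃ k : ℕ, a (s / ((p : ℕ) : ℚ) ^ k) ≠ 0 := by
  classical
  have hp0 : ((p : ℕ) : ℚ) ≠ 0 := Nat.cast_ne_zero.2 p.ne_zero
  let g : ℚ → U := fun s =>
    if s = 0 then 0 else ∑ᶠ k : ℕ, T^[k] (a (s / ((p : ℕ) : ℚ) ^ k))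
  have hg : ∀ s, s ≠ 0 → ∀ K : ℕ, (∀ k, K ≤ k → a (s / ((p : ℕ) : ℚ) ^ k) = 0) →
      g s = ∑ k ∈ Finset.range K, T^[k] (a (s / ((p : ℕ) : ℚ) ^ k)) := by
    intro s hs K hK
    simp only [g, if_neg hs]
    refine finsum_eq_sum_of_support_subset _ fun k hk => ?_
    rw [Finset.coe_range, Set.mem_Iio]
    by_contra hlt
    rw [Function.mem_support, hK k (not_lt.1 hlt), iterate_map_zero] at hk
    exact hk rfl
  refine ⟨g, fun s hs => ?_, fun s hs => ?_⟩
  · obtain ⟨K, hK⟩ := not_int_div_pow hp hr hs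
    have hK' : ∀ k, K ≤ k → a (s / ((p : ℕ) : ℚ) ^ k) = 0 := fun k hk => by
      by_contra h0
      exact hK k hk (ha _ h0)
    have hdiv : ∀ k, s / ((p : ℕ) : ℚ) / ((p : ℕ) : ℚ) ^ k = s / ((p : ℕ) : ℚ) ^ (k + 1) :=
      fun k => by rw [div_div, ← pow_succ']
    rw [hg s hs (K + 1) fun k hk => hK' k (by omega),
      hg (s / ((p : ℕ) : ℚ)) (div_ne_zero hs hp0) K fun k hk => by
        rw [hdiv]
        exact hK' _ (by omega),
      Finset.sum_range_succ', map_sum, add_comm]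
    congr 1
    · simp
    · refine Finset.sum_congr rfl fun k _ => ?_
      rw [hdiv, Function.iterate_succ_apply']
  · by_contra! h0
    refine hs ?_
    simp only [g, h0, iterate_map_zero, finsum_zero, ite_self]

/-- Uniqueness for the recursion `h s M = l h(s / p)`: a nonzero exponent in the support of `h`
would force `s / p^k` into the support for all `k`, against the bounded denominators. -/
theorem eq_zero_of_vecMul_eq {p : ℕ+} (hp : 2 ≤ p) {ι : Type*} [Fintype ι] [DecidableEq ι]
    {M : Matrix ι ι C} (hM : IsUnit M.det) {l : C} {r : ℕ} (hr : r ≠ 0) {h : ℚ → ι → C}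
    (hint : ∀ s, h s ≠ 0 → ∃ k : ℤ, (r : ℚ) * s = k)
    (heq : ∀ s, s ≠ 0 → h s ᵥ* M = l • h (s / ((p : ℕ) : ℚ))) {s : ℚ} (hs : s ≠ 0) :
    h s = 0 := by
  by_contra hne
  have hp0 : ((p : ℕ) : ℚ) ≠ 0 := Nat.cast_ne_zero.2 p.ne_zero
  have hk : ∀ k : ℕ, h (s / ((p : ℕ) : ℚ) ^ k) ≠ 0 := by
    intro k
    induction k with
    | zero => simpa using hne
    | succ k ih =>
      intro h0
      have h1 := heq (s / ((p : ℕ) : ℚ) ^ k) (div_ne_zero hs (pow_ne_zero _ hp0))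
      rw [div_div, ← pow_succ, h0, smul_zero] at h1
      have h2 := congrArg (· ᵥ* M⁻¹) h1
      simp only [Matrix.vecMul_vecMul, Matrix.mul_nonsing_inv M hM, Matrix.vecMul_one,
        Matrix.zero_vecMul] at h2
      exact ih h2
  obtain ⟨k, hk0⟩ := not_int_div_pow hp hr hs
  exact hk0 k le_rfl (hint _ (hk k))

/-- The two recursions that split an extension have a common solution `g`, whose support is
bounded below. The solution of the first recursion solves the second as well by uniqueness.
If `g s ≠ 0` for some exponent `s` beyond the poles of `b`, then `g (s q^j) ≠ 0` for all `j` by the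
second recursion, while by the first every `s q^j` is a power of `p` times one of the finitely many
negative exponents of `a`; so two powers of `q` differ by a power of `p`, against multiplicative
independence. -/
theorem exists_common_orbit_sum {p q : ℕ+} (hp : 2 ≤ p) (hq : 2 ≤ q)
    (hpq : MultiplicativelyIndependent p q) {ι : Type*} [Fintype ι] [DecidableEq ι]
    {M N : Matrix ι ι C} (hM : IsUnit M.det) (hMN : M * N = N * M) {l u : C} (hu : u ≠ 0)
    {a b : ℚ → ι → C} {n : ℕ} (ha : BoundedBy n a) (hb : BoundedBy n b)
    (hab : ∀ s, a s ᵥ* N + l • b (s / ((p : ℕ) : ℚ)) =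
      b s ᵥ* M + u • a (s / ((q : ℕ) : ℚ))) :
    ∃ g : ℚ → ι → C, BoundedBy n g ∧ ∀ s, s ≠ 0 →
      g s ᵥ* M = a s + l • g (s / ((p : ℕ) : ℚ)) ∧
      g s ᵥ* N = b s + u • g (s / ((q : ℕ) : ℚ)) := by
  have hp0 : ((p : ℕ) : ℚ) ≠ 0 := Nat.cast_ne_zero.2 p.ne_zero
  have hq0 : ((q : ℕ) : ℚ) ≠ 0 := Nat.cast_ne_zero.2 q.ne_zero
  have hn : (0 : ℚ) < n.factorial := Nat.cast_pos.2 n.factorial_pos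
  have ha' : ∀ s, a s ᵥ* M⁻¹ ≠ 0 → a s ≠ 0 := fun s hs h0 => hs (by rw [h0, Matrix.zero_vecMul])
  obtain ⟨g, hg, hsupp⟩ := exists_orbit_sum hp (l • Matrix.vecMulLinear M⁻¹).toAddMonoidHom
    n.factorial_ne_zero (fun s => a s ᵥ* M⁻¹) fun s hs => (ha s (ha' s hs)).1
  have hgM : ∀ s, s ≠ 0 → g s ᵥ* M = a s + l • g (s / ((p : ℕ) : ℚ)) := by
    intro s hs
    rw [hg s hs]
    simp [Matrix.add_vecMul, Matrix.smul_vecMul, Matrix.vecMul_vecMul,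
      Matrix.nonsing_inv_mul M hM]
  have hgint : ∀ s, g s ≠ 0 → ∃ k : ℤ, (n.factorial : ℚ) * s = k := by
    intro s hs
    obtain ⟨k, hk⟩ := hsupp s hs
    obtain ⟨z, hz⟩ := (ha _ (ha' _ hk)).1
    refine ⟨z * (p : ℕ) ^ k, ?_⟩
    push_cast
    rw [← hz]
    field_simp
  have hgN : ∀ s, s ≠ 0 → g s ᵥ* N = b s + u • g (s / ((q : ℕ) : ℚ)) := by
    intro s hs
    have hzero := eq_zero_of_vecMul_eq hp hM (l := l) n.factorial_ne_zero
      (h := fun s => g s ᵥ* N - (b s + u • g (s / ((q : ℕ) : ℚ))))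
      (fun s hs => by
        by_contra hnot
        have h1 : g s = 0 := by
          by_contra h
          exact hnot (hgint s h)
        have h2 : b s = 0 := by
          by_contra h
          exact hnot (hb s h).1
        have h3 : g (s / ((q : ℕ) : ℚ)) = 0 := by
          by_contra h
          obtain ⟨k, hk⟩ := hgint _ h
          refine hnot ⟨k * (q : ℕ), ?_⟩
          push_cast
          rw [← hk]
          field_simp
        exact hs (by simp [h1, h2, h3]))
      (fun s hs => by
        have e1 : g s ᵥ* N ᵥ* M = a s ᵥ* N + l • (g (s / ((p : ℕ) : ℚ)) ᵥ* N) := by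
          rw [Matrix.vecMul_vecMul, ← hMN, ← Matrix.vecMul_vecMul, hgM s hs, Matrix.add_vecMul,
            Matrix.smul_vecMul]
        have e2 := hgM (s / ((q : ℕ) : ℚ)) (div_ne_zero hs hq0)
        have e3 := hab s
        rw [div_right_comm] at e2
        rw [Matrix.sub_vecMul, Matrix.add_vecMul, e1, Matrix.smul_vecMul, e2,
          eq_sub_of_add_eq e3]
        simp only [smul_sub, smul_add, smul_smul]
        rw [mul_comm l u]
        abel)
      hs
    exact sub_eq_zero.1 hzero
  refine ⟨g, fun s hs => ⟨hgint s hs, ?_⟩, fun s hs => ⟨hgM s hs, hgN s hs⟩⟩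
  by_contra! hlt
  have hq1 : (1 : ℚ) ≤ ((q : ℕ) : ℚ) := by exact_mod_cast q.pos
  have hn0 : (0 : ℚ) ≤ n := Nat.cast_nonneg n
  have hs0 : s < 0 := by linarith
  have hle : ∀ j : ℕ, s * ((q : ℕ) : ℚ) ^ j ≤ s := fun j => by
    have : (1 : ℚ) ≤ ((q : ℕ) : ℚ) ^ j := one_le_pow₀ hq1
    nlinarith
  have hgj : ∀ j : ℕ, g (s * ((q : ℕ) : ℚ) ^ j) ≠ 0 := by
    intro j
    induction j with
    | zero => simpa using hs
    | succ j ih =>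
      intro h0
      have h1 := hgN (s * ((q : ℕ) : ℚ) ^ (j + 1)) (mul_ne_zero hs0.ne (pow_ne_zero _ hq0))
      have h2 : b (s * ((q : ℕ) : ℚ) ^ (j + 1)) = 0 := by
        by_contra h
        have := (hb _ h).2
        have := hle (j + 1)
        linarith
      have h3 : s * ((q : ℕ) : ℚ) ^ (j + 1) / ((q : ℕ) : ℚ) = s * ((q : ℕ) : ℚ) ^ j := by
        rw [pow_succ]
        field_simp
      rw [h0, h2, h3, Matrix.zero_vecMul, zero_add] at h1
      exact ih ((smul_eq_zero.1 h1.symm).resolve_left hu)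
  -- Each `s q^j` is `p^(k j)` times an exponent `z j / n!` of `a`, with `z j` in a finite interval.
  choose k hk using fun j => hsupp _ (hgj j)
  choose z hz using fun j => (ha _ (ha' _ (hk j))).1
  have hz0 : ∀ j, z j ∈ Set.Icc (-(n * n.factorial : ℤ)) 0 := by
    intro j
    have hpk : (0 : ℚ) < ((p : ℕ) : ℚ) ^ k j := pow_pos (Nat.cast_pos.2 p.pos) _
    constructor
    · have h1 := (ha _ (ha' _ (hk j))).2
      have h2 : ((-(n * n.factorial : ℤ) : ℤ) : ℚ) ≤ z j := by
        rw [← hz j]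
        push_cast
        nlinarith
      exact_mod_cast h2
    · have h1 : s * ((q : ℕ) : ℚ) ^ j / ((p : ℕ) : ℚ) ^ k j ≤ 0 :=
        div_nonpos_of_nonpos_of_nonneg ((hle j).trans hs0.le) hpk.le
      have h2 : (z j : ℚ) ≤ 0 := by
        rw [← hz j]
        exact mul_nonpos_of_nonneg_of_nonpos hn.le h1
      exact_mod_cast h2
  obtain ⟨i, j, hij, heq⟩ := Finite.exists_ne_map_eq_of_infinite
    (fun j => (⟨z j, hz0 j⟩ : Set.Icc (-(n * n.factorial : ℤ)) 0))
  have heq' : z i = z j := congrArg Subtype.val heq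
  have h1 := (hz i).trans ((congrArg (Int.cast : ℤ → ℚ) heq').trans (hz j).symm)
  have h2 := mul_left_cancel₀ hn.ne' h1
  rw [div_eq_div_iff (pow_ne_zero _ hp0) (pow_ne_zero _ hp0), mul_assoc, mul_assoc] at h2
  have h3 := mul_left_cancel₀ hs0.ne h2
  by_cases hkk : k i = k j
  · rw [hkk] at h3
    have h4 := mul_right_cancel₀ (pow_ne_zero _ hp0) h3
    have hq2 : 2 ≤ (q : ℕ) := hq
    have h5 : (q : ℕ) ^ i = (q : ℕ) ^ j := by exact_mod_cast h4
    exact hij (Nat.pow_right_injective hq2 h5)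
  · refine hpq (k j - k i : ℤ) (j - i : ℤ) (by omega) (by omega) ?_
    rw [zpow_sub₀ hp0, zpow_sub₀ hq0, zpow_natCast, zpow_natCast, zpow_natCast, zpow_natCast,
      div_eq_div_iff (pow_ne_zero _ hp0) (pow_ne_zero _ hq0)]
    linear_combination h3

theorem mahler_mul_const_coeff (l : C) (p : ℕ+) (f : Puiseux C) (s : ℚ) :
    (mahler C p f * const C l).1.coeff s = l * f.1.coeff (s / ((p : ℕ) : ℚ)) := by
  rw [mul_comm, const_mul_coeff, mahler_coeff]

theorem sum_mul_const_coeff {ι : Type*} [Fintype ι] (f : ι → Puiseux C) (M : Matrix ι ι C) (j : ι)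
    (s : ℚ) :
    (∑ i, const C (M i j) * f i).1.coeff s = ((fun i => (f i).1.coeff s) ᵥ* M) j := by
  rw [sum_coeff]
  exact Finset.sum_congr rfl fun i _ => by rw [const_mul_coeff, mul_comm]

theorem add_coeff (f g : Puiseux C) (s : ℚ) :
    (f + g).1.coeff s = f.1.coeff s + g.1.coeff s := rfl

theorem sub_coeff (f g : Puiseux C) (s : ℚ) :
    (f - g).1.coeff s = f.1.coeff s - g.1.coeff s := rfl

theorem exists_common_boundedBy {ι : Type*} [Finite ι] (a b : ι → Puiseux C) :
    ∃ n, BoundedBy n (fun s i => (a i).1.coeff s) ∧ BoundedBy n (fun s i => (b i).1.coeff s) := by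
  obtain ⟨n, hn⟩ := (Filter.eventually_all.2 fun i =>
    (eventually_boundedBy (a i)).and (eventually_boundedBy (b i))).exists
  refine ⟨n, fun s hs => ?_, fun s hs => ?_⟩
  · obtain ⟨i, hi⟩ := Function.ne_iff.1 hs
    exact (hn i).1 s hi
  · obtain ⟨i, hi⟩ := Function.ne_iff.1 hs
    exact (hn i).2 s hi

/-- If the coefficient matrices of a consistent pair are `[[l, a], [0, M]]` and `[[u, b], [0, N]]`
with `l`, `u`, `M`, `N` constant, then a gauge transformation `[[1, g], [0, 1]]` makes both
rows `a` and `b` constant. -/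
theorem exists_gauge_row {p q : ℕ+} (hp : 2 ≤ p) (hq : 2 ≤ q)
    (hpq : MultiplicativelyIndependent p q) {ι : Type*} [Fintype ι] [DecidableEq ι]
    {M N : Matrix ι ι C} (hM : IsUnit M.det) (hMN : M * N = N * M) {l u : C} (hu : u ≠ 0)
    (a b : ι → Puiseux C)
    (hab : ∀ j, ∑ i, const C (N i j) * a i + mahler C p (b j) * const C l =
      ∑ i, const C (M i j) * b i + mahler C q (a j) * const C u) :
    ∃ (g : ι → Puiseux C) (α β : ι → C), ∀ j,
      a j + mahler C p (g j) * const C l = const C (α j) + ∑ i, const C (M i j) * g i ∧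
      b j + mahler C q (g j) * const C u = const C (β j) + ∑ i, const C (N i j) * g i := by
  obtain ⟨n, ha, hb⟩ := exists_common_boundedBy a b
  obtain ⟨g, hgn, hg⟩ := exists_common_orbit_sum hp hq hpq hM hMN (l := l) hu ha hb (fun s => by
    funext j
    have := congrArg (fun f : Puiseux C => f.1.coeff s) (hab j)
    simp only [add_coeff, mahler_mul_const_coeff, sum_mul_const_coeff] at this
    exact this)
  choose G hG using fun i => exists_puiseux (fun s => g s i) n.factorial n.factorial_ne_zero (-n)
    fun s hs => hgn s fun h0 => hs (congrFun h0 i)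
  have hG' : ∀ s, (fun i => (G i).1.coeff s) = g s := fun s => by
    funext i
    rw [hG]
  have key : ∀ (r : ℕ+) (P : Matrix ι ι C) (t : C) (f : ι → Puiseux C)
      (_ : ∀ s, s ≠ 0 → g s ᵥ* P =
        (fun i => (f i).1.coeff s) + t • g (s / ((r : ℕ) : ℚ))) (j : ι), ∃ c,
      f j + mahler C r (G j) * const C t = const C c + ∑ i, const C (P i j) * G i := by
    intro r P t f h j
    refine ⟨_, sub_eq_iff_eq_add.1 (eq_const_of_coeff_eq_zero fun s hs => ?_)⟩
    rw [sub_coeff, add_coeff, mahler_mul_const_coeff, sum_mul_const_coeff, hG', h s hs, hG]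
    simp
  choose α hα using key p M l a fun s hs => (hg s hs).1
  choose β hβ using key q N u b fun s hs => (hg s hs).2
  exact ⟨G, α, β, fun j => ⟨hα j, hβ j⟩⟩

/-! ### Simultaneous reduction to constant matrices -/

/-- An injective Mahler operator has an invertible matrix, when this matrix is constant. -/
theorem isUnit_det_of_injective {p : ℕ+} {V : Type*} [AddCommGroup V] [Module (Puiseux C) V]
    (Φ : V →ₛₗ[mahler C p] V) (hΦ : Function.Injective Φ) {ι : Type*} [Fintype ι]
    [DecidableEq ι] (e : Module.Basis ι (Puiseux C) V) (M : Matrix ι ι C)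
    (hM : ∀ j, Φ (e j) = ∑ i, const C (M i j) • e i) : IsUnit M.det := by
  rw [isUnit_iff_ne_zero]
  intro h0
  obtain ⟨v, hv, hMv⟩ := Matrix.exists_mulVec_eq_zero_iff.2 h0
  have h1 : Φ (∑ j, const C (v j) • e j) = 0 := by
    simp only [map_sum, LinearMap.map_smulₛₗ, mahler_const, hM, Finset.smul_sum, smul_smul]
    rw [Finset.sum_comm]
    refine Finset.sum_eq_zero fun i _ => ?_
    rw [← Finset.sum_smul]
    have h2 : ∑ j, const C (v j) * const C (M i j) = const C ((M *ᵥ v) i) := by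
      simp only [← map_mul, ← map_sum, Matrix.mulVec, dotProduct, mul_comm]
    rw [h2, hMv, Pi.zero_apply, map_zero, zero_smul]
  have h3 := hΦ (h1.trans (map_zero Φ).symm)
  refine hv (funext fun j => ?_)
  exact (map_eq_zero (const C)).1
    (Fintype.linearIndependent_iff.1 e.linearIndependent _ h3 j)

/-- Passing to the quotient by an eigenvector preserves injectivity; this uses that every Puiseux
series is of the form `f(x^p)`. -/
theorem mapQ_injective {p : ℕ+} {V : Type*} [AddCommGroup V] [Module (Puiseux C) V]
    (Φ : V →ₛₗ[mahler C p] V) (hΦ : Function.Injective Φ) {w : V} {l : C} (hl : l ≠ 0)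
    (hw : Φ w = const C l • w)
    (h : Submodule.span (Puiseux C) {w} ≤ (Submodule.span (Puiseux C) {w}).comap Φ) :
    Function.Injective (Submodule.mapQ _ _ Φ h) := by
  refine (injective_iff_map_eq_zero _).2 fun x hx => ?_
  obtain ⟨v, rfl⟩ := Submodule.Quotient.mk_surjective _ x
  rw [Submodule.mapQ_apply, Submodule.Quotient.mk_eq_zero, Submodule.mem_span_singleton] at hx
  obtain ⟨c, hc⟩ := hx
  have hl' : const C l ≠ 0 := (map_ne_zero (const C)).2 hl
  obtain ⟨d, hd⟩ := mahler_surjective p (c * (const C l)⁻¹)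
  rw [Submodule.Quotient.mk_eq_zero, Submodule.mem_span_singleton]
  refine ⟨d, hΦ ?_⟩
  rw [LinearMap.map_smulₛₗ, hd, hw, smul_smul, inv_mul_cancel_right₀ hl', hc]

theorem linearIndependent_cons_of_quotient {K V : Type*} [Field K] [AddCommGroup V] [Module K V]
    {n : ℕ} {w : V} (hw : w ≠ 0) (e : Fin n → V)
    (h : LinearIndependent K fun j => (Submodule.span K {w}).mkQ (e j)) :
    LinearIndependent K (Fin.cons w e : Fin (n + 1) → V) := by
  refine linearIndependent_finCons.2 ⟨LinearIndependent.of_comp _ h, fun hmem => ?_⟩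
  obtain ⟨c, hc⟩ := (Submodule.mem_span_range_iff_exists_fun K).1 hmem
  have h1 := congrArg (Submodule.span K {w}).mkQ hc
  rw [map_sum, Submodule.mkQ_apply _ w, (Submodule.Quotient.mk_eq_zero _).2
    (Submodule.mem_span_singleton_self w)] at h1
  simp only [map_smul] at h1
  have h2 := Fintype.linearIndependent_iff.1 h c h1
  exact hw (by rw [← hc]; exact Finset.sum_eq_zero fun i _ => by rw [h2, zero_smul])

theorem eq_of_smul_add_sum_eq {K V : Type*} [Field K] [AddCommGroup V] [Module K V]
    {n : ℕ} {w : V} {e : Fin n → V}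
    (h : LinearIndependent K (Fin.cons w e : Fin (n + 1) → V)) {x y : K} {c d : Fin n → K}
    (heq : x • w + ∑ i, c i • e i = y • w + ∑ i, d i • e i) : x = y ∧ c = d := by
  have h1 : ∀ (x : K) (c : Fin n → K), x • w + ∑ i, c i • e i =
      Fintype.linearCombination K (Fin.cons w e : Fin (n + 1) → V) (Fin.cons x c) := by
    intro x c
    simp [Fintype.linearCombination_apply, Fin.sum_univ_succ]
  rw [h1, h1] at heq
  exact Fin.cons_inj.1 (h.fintypeLinearCombination_injective heq)

/-- The coefficients of `Θ v` along `w` and the `e i`, when `v` has constant coefficients along the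
`e i`. With `v = Ψ (e j)` this turns commutation of operators into equations between matrices. -/
theorem apply_lift {r : ℕ+} {V : Type*} [AddCommGroup V] [Module (Puiseux C) V]
    (Θ : V →ₛₗ[mahler C r] V) {w : V} {t : C} (hw : Θ w = const C t • w) {ι : Type*} [Fintype ι]
    (e : ι → V) (f : ι → Puiseux C) (P : Matrix ι ι C)
    (h : ∀ j, Θ (e j) = f j • w + ∑ i, const C (P i j) • e i) (x : Puiseux C)
    (Q : Matrix ι ι C) (j : ι) :
    Θ (x • w + ∑ i, const C (Q i j) • e i) =
      (∑ i, const C (Q i j) * f i + mahler C r x * const C t) • w +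
        ∑ i, const C ((P * Q) i j) • e i := by
  simp only [map_add, map_sum, LinearMap.map_smulₛₗ, mahler_const, hw, h, smul_add,
    Finset.sum_add_distrib, smul_smul, Finset.smul_sum, Matrix.mul_apply, map_mul, add_smul,
    Finset.sum_smul]
  rw [Finset.sum_comm]
  simp only [mul_comm (const C (Q _ j)) (const C (P _ _))]
  abel

/-- The matrix `[[t, γ], [0, P]]`. -/
def bordered {n : ℕ} (t : C) (γ : Fin n → C) (P : Matrix (Fin n) (Fin n) C) :
    Matrix (Fin (n + 1)) (Fin (n + 1)) C :=
  Matrix.of fun i j => (Fin.cons (Fin.cons t 0) (fun j => Fin.cons (γ j) fun i => P i j) :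
    Fin (n + 1) → Fin (n + 1) → C) j i

theorem apply_cons {r : ℕ+} {V : Type*} [AddCommGroup V] [Module (Puiseux C) V]
    (Θ : V →ₛₗ[mahler C r] V) {w : V} {t : C} (hw : Θ w = const C t • w) {n : ℕ}
    (e : Fin n → V) (γ : Fin n → C) (P : Matrix (Fin n) (Fin n) C)
    (h : ∀ j, Θ (e j) = const C (γ j) • w + ∑ i, const C (P i j) • e i) (j : Fin (n + 1)) :
    Θ ((Fin.cons w e : Fin (n + 1) → V) j) =
      ∑ i, const C (bordered t γ P i j) • (Fin.cons w e : Fin (n + 1) → V) i := by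
  rw [Fin.sum_univ_succ]
  refine Fin.cases ?_ (fun j => ?_) j
  · simp [bordered, hw]
  · simp [bordered, h]

/-- Commuting injective Mahler operators have constant matrices in a common basis. -/
theorem exists_basis_const [IsAlgClosed C] {p q : ℕ+} (hp : 2 ≤ p) (hq : 2 ≤ q)
    (hpq : MultiplicativelyIndependent p q) (n : ℕ) {V : Type*} [AddCommGroup V]
    [Module (Puiseux C) V] [Module.Finite (Puiseux C) V]
    (Φ : V →ₛₗ[mahler C p] V) (Ψ : V →ₛₗ[mahler C q] V) (hΦ : Function.Injective Φ)
    (hΨ : Function.Injective Ψ) (hcomm : ∀ v, Φ (Ψ v) = Ψ (Φ v))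
    (hn : Module.finrank (Puiseux C) V = n) :
    ∃ (e : Module.Basis (Fin n) (Puiseux C) V) (M N : Matrix (Fin n) (Fin n) C),
      (∀ j, Φ (e j) = ∑ i, const C (M i j) • e i) ∧
      ∀ j, Ψ (e j) = ∑ i, const C (N i j) • e i := by
  induction n generalizing V with
  | zero => exact ⟨Module.finBasisOfFinrankEq _ _ hn, 0, 0, fun j => j.elim0, fun j => j.elim0⟩
  | succ n ih =>
    have : Nontrivial V := Module.nontrivial_of_finrank_pos (R := Puiseux C) (by omega)
    obtain ⟨w, l, u, hw, hl, hu, hΦw, hΨw⟩ := exists_common_eigenvector hp Φ Ψ hΦ hΨ hcomm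
    set S := Submodule.span (Puiseux C) {w} with hS
    have hΦS : S ≤ S.comap Φ := by
      rw [hS, Submodule.span_singleton_le_iff_mem, Submodule.mem_comap, hΦw]
      exact Submodule.smul_mem _ _ (Submodule.mem_span_singleton_self w)
    have hΨS : S ≤ S.comap Ψ := by
      rw [hS, Submodule.span_singleton_le_iff_mem, Submodule.mem_comap, hΨw]
      exact Submodule.smul_mem _ _ (Submodule.mem_span_singleton_self w)
    have hQ : Module.finrank (Puiseux C) (V ⧸ S) = n := by
      have h1 := Submodule.finrank_quotient_add_finrank S
      rw [finrank_span_singleton hw] at h1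
      omega
    obtain ⟨e', M, N, hM, hN⟩ := ih (S.mapQ S Φ hΦS) (S.mapQ S Ψ hΨS)
      (mapQ_injective Φ hΦ hl hΦw hΦS) (mapQ_injective Ψ hΨ hu hΨw hΨS)
      (fun x => by
        obtain ⟨v, rfl⟩ := Submodule.Quotient.mk_surjective _ x
        simp only [Submodule.mapQ_apply, hcomm]) hQ
    have hMu := isUnit_det_of_injective _ (mapQ_injective Φ hΦ hl hΦw hΦS) e' M hM
    -- Lift the basis of the quotient; the lifts are corrected by multiples of `w` below.
    choose e he using fun j => Submodule.Quotient.mk_surjective S (e' j)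
    have hlift : ∀ (r : ℕ+) (Θ : V →ₛₗ[mahler C r] V) (hΘ : S ≤ S.comap Θ)
        (P : Matrix (Fin n) (Fin n) C)
        (_ : ∀ j, S.mapQ S Θ hΘ (e' j) = ∑ i, const C (P i j) • e' i) (j : Fin n),
        ∃ c : Puiseux C, Θ (e j) = c • w + ∑ i, const C (P i j) • e i := by
      intro r Θ hΘ P hP j
      have h1 := hP j
      simp only [← he, Submodule.mapQ_apply] at h1
      have h2 : Θ (e j) - ∑ i, const C (P i j) • e i ∈ S := by
        rw [← Submodule.Quotient.mk_eq_zero, Submodule.Quotient.mk_sub, h1, sub_eq_zero,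
          ← Submodule.mkQ_apply, map_sum]
        rfl
      obtain ⟨c, hc⟩ := Submodule.mem_span_singleton.1 h2
      exact ⟨c, by rw [hc, sub_add_cancel]⟩
    choose a ha using hlift p Φ hΦS M hM
    choose b hb using hlift q Ψ hΨS N hN
    have hΦΨ := apply_lift Φ hΦw e a M ha
    have hΨΦ := apply_lift Ψ hΨw e b N hb
    have hLI : ∀ g : Fin n → Puiseux C,
        LinearIndependent (Puiseux C) (Fin.cons w fun j => e j + g j • w : Fin (n + 1) → V) := by
      refine fun g => linearIndependent_cons_of_quotient hw _ ?_
      have h1 : (fun j => S.mkQ (e j + g j • w)) = e' := by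
        funext j
        rw [map_add, map_smul, Submodule.mkQ_apply, Submodule.mkQ_apply, he,
          (Submodule.Quotient.mk_eq_zero S).2 (Submodule.mem_span_singleton_self w), smul_zero,
          add_zero]
      rw [h1]
      exact e'.linearIndependent
    have hLI0 : LinearIndependent (Puiseux C) (Fin.cons w e : Fin (n + 1) → V) := by
      simpa using hLI 0
    have hcom : ∀ j, ∑ i, const C (N i j) * a i + mahler C p (b j) * const C l =
        ∑ i, const C (M i j) * b i + mahler C q (a j) * const C u ∧
        ∀ i, (M * N) i j = (N * M) i j := by
      intro j
      have h1 := hcomm (e j)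
      rw [ha, hb, hΦΨ, hΨΦ] at h1
      obtain ⟨h2, h3⟩ := eq_of_smul_add_sum_eq hLI0 h1
      exact ⟨h2, fun i => (const C).injective (congrFun h3 i)⟩
    obtain ⟨g, α, β, hg⟩ := exists_gauge_row hp hq hpq hMu
      (Matrix.ext fun i j => (hcom j).2 i) hu a b fun j => (hcom j).1
    have hgauge : ∀ (r : ℕ+) (Θ : V →ₛₗ[mahler C r] V) (t : C) (_ : Θ w = const C t • w)
        (f : Fin n → Puiseux C) (P : Matrix (Fin n) (Fin n) C)
        (_ : ∀ j, Θ (e j) = f j • w + ∑ i, const C (P i j) • e i) (γ : Fin n → C)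
        (_ : ∀ j, f j + mahler C r (g j) * const C t = const C (γ j) + ∑ i, const C (P i j) * g i)
        (j : Fin n), Θ (e j + g j • w) =
          const C (γ j) • w + ∑ i, const C (P i j) • (e i + g i • w) := by
      intro r Θ t hw f P hf γ hγ j
      rw [map_add, LinearMap.map_smulₛₗ, hw, hf, smul_smul, add_right_comm, ← add_smul, hγ]
      simp only [smul_add, Finset.sum_add_distrib, smul_smul, add_smul, Finset.sum_smul]
      abel
    let E : Module.Basis (Fin (n + 1)) (Puiseux C) V :=
      basisOfLinearIndependentOfCardEqFinrank (hLI g) (by rw [Fintype.card_fin, hn])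
    have hE : ⇑E = Fin.cons w fun j => e j + g j • w :=
      coe_basisOfLinearIndependentOfCardEqFinrank _ _
    refine ⟨E, bordered l α M, bordered u β N, ?_, ?_⟩
    · rw [hE]
      exact apply_cons Φ hΦw _ α M (hgauge p Φ l hΦw a M ha α fun j => (hg j).1)
    · rw [hE]
      exact apply_cons Ψ hΨw _ β N (hgauge q Ψ u hΨw b N hb β fun j => (hg j).2)

/-! ### From modules to systems -/

theorem mahler_comm (p q : ℕ+) (f : Puiseux C) :
    mahler C p (mahler C q f) = mahler C q (mahler C p f) :=
  puiseux_ext fun s => by simp only [mahler_coeff, div_right_comm]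

/-- The semilinear operator `v ↦ A⁻¹ v(x^p)`, whose fixed vectors are the solutions of
`y(x^p) = A(x) y(x)`. -/
def mahlerOp {n : ℕ} (p : ℕ+) (A : GL (Fin n) (Puiseux C)) :
    (Fin n → Puiseux C) →ₛₗ[mahler C p] (Fin n → Puiseux C) where
  toFun v := (A⁻¹).1 *ᵥ (mahler C p ∘ v)
  map_add' v w := by
    rw [← Matrix.mulVec_add]
    congr 1
    funext i
    exact map_add _ _ _
  map_smul' c v := by
    rw [← Matrix.mulVec_smul]
    congr 1
    funext i
    exact map_mul _ _ _

theorem mahlerOp_apply {n : ℕ} (p : ℕ+) (A : GL (Fin n) (Puiseux C)) (v : Fin n → Puiseux C) :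
    mahlerOp p A v = (A⁻¹).1 *ᵥ (mahler C p ∘ v) := rfl

theorem mahlerOp_injective {n : ℕ} (p : ℕ+) (A : GL (Fin n) (Puiseux C)) :
    Function.Injective (mahlerOp p A) := by
  intro v w h
  have h1 := congrArg (A.1 *ᵥ ·) h
  simp only [mahlerOp_apply, Matrix.mulVec_mulVec, ← Units.val_mul, mul_inv_cancel,
    Units.val_one, Matrix.one_mulVec] at h1
  exact funext fun i => (mahler C p).injective (congrFun h1 i)

theorem mahlerOp_mahlerOp {n : ℕ} (p q : ℕ+) (A B : GL (Fin n) (Puiseux C))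
    (v : Fin n → Puiseux C) :
    mahlerOp p A (mahlerOp q B v) =
      ((mahlerGL p B * A)⁻¹).1 *ᵥ (mahler C p ∘ mahler C q ∘ v) := by
  have h : mahler C p ∘ ((B⁻¹).1 *ᵥ (mahler C q ∘ v)) =
      ((mahlerGL p B)⁻¹).1 *ᵥ (mahler C p ∘ mahler C q ∘ v) := by
    funext i
    rw [Function.comp_apply, RingHom.map_mulVec, mahlerGL, ← map_inv]
    rfl
  rw [mahlerOp_apply, mahlerOp_apply, h, Matrix.mulVec_mulVec, ← Units.val_mul, mul_inv_rev]

end MahlerSystem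

end

theorem mainTheorem11 (C : Type*) [Field C] [IsAlgClosed C] [CharZero C]
    (p q : ℕ+) (hp : 2 ≤ p) (hq : 2 ≤ q)
    (hpq : MahlerSystem.MultiplicativelyIndependent p q)
    (n : ℕ) (A B : GL (Fin n) (MahlerSystem.Puiseux C))
    (hAB : MahlerSystem.IsConsistent p q A B) :
    MahlerSystem.IsRegularSingularAtZero p A := by
  open MahlerSystem in
  obtain ⟨e, M, -, hM, -⟩ := exists_basis_const hp hq hpq n (mahlerOp p A) (mahlerOp q B)
    (mahlerOp_injective p A) (mahlerOp_injective q B) (fun v => by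
      have hv : mahler C p ∘ mahler C q ∘ v = mahler C q ∘ mahler C p ∘ v :=
        funext fun i => mahler_comm p q (v i)
      rw [mahlerOp_mahlerOp, mahlerOp_mahlerOp, hv, hAB]) (by simp)
  have hMu := isUnit_det_of_injective _ (mahlerOp_injective p A) e M hM
  obtain ⟨M', hM'⟩ := (Matrix.isUnit_iff_isUnit_det M).2 hMu
  -- The columns of the gauge matrix are the basis vectors.
  obtain ⟨G, hG⟩ : IsUnit (Matrix.of fun i j => e j i) :=
    Matrix.linearIndependent_cols_iff_isUnit.1 e.linearIndependent
  have hGM : A⁻¹ * mahlerGL p G = G * constGL M' := by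
    refine Units.ext (Matrix.ext fun i j => ?_)
    have h1 := congrFun (hM j) i
    have h2 : ∀ j, (fun i => G.1 i j) = e j := fun j => by rw [hG]; rfl
    rw [mahlerOp_apply, ← h2, Finset.sum_apply] at h1
    refine Eq.trans ?_ (h1.trans ?_)
    · rfl
    · rw [Units.val_mul, Matrix.mul_apply]
      refine Finset.sum_congr rfl fun k _ => ?_
      rw [Pi.smul_apply, ← h2, smul_eq_mul, mul_comm, ← hM']
      rfl
  refine ⟨G, M'⁻¹, ?_⟩
  rw [inv_mul_eq_iff_eq_mul] at hGM
  have hinv : constGL M'⁻¹ = (constGL M')⁻¹ := map_inv _ _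
  rw [gaugeTransform, hGM, hinv]
  group
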